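/- Let $G$ be a finite simple graph with vertex set $V$. A Colin de Verdière matrix for $G$ is a real symmetric matrix $M=(M_{ij})_{i,j\in V}$ such that: (M1) $M_{ij}<0$ if $ij$ is an edge of $G$, and $M_{ij}=0$ if $i\neq j$ and $ij$ is not an edge; (M2) $M$ has exactly one negative eigenvalue, and this eigenvalue is simple; (M3) if $X$ is a real symmetric matrix with $MX=0$ and $X_{ij}=0$ whenever $i=j$ or $ij$ is an edge, then $X=0$. Let $M$ be a Colin de Verdière matrix for $G$ with $d=\dim\ker M\ge 3$, let $(u_1,\dots,u_d)$ be a basis of $\ker M\subset\mathbb R^V$, and for $i\in V$ let $v_i=((u_1)_i,\dots,(u_d)_i)\in\mathbb R^d$ (a nullspace representation of $G$). For an edge $ij$ let $v_{ij}$ be the orthogonal projection of $v_j$ on the hyperplane $v_i^\perp$, let $\theta_{ij}$ be the angle between $v_i$ and $v_j$, and put $$A_{ij}=-M_{ij}\,\|v_i\|\,\|v_j\|\sin\theta_{ij}.$$ Assume that 1. $v_i\neq 0$ for all $i$, and $v_i\neq v_j$ for all $i\neq j$; 2. for every $i$, the vectors $v_{ij}$, $j$ adjacent to $i$, are nonzero,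 no two of them (for distinct $j$) are positive multiples of each other, and they span $v_i^\perp$. Then for every $i\in V$ there exists a convex polytope $F_i\subset v_i^\perp$ of dimension $d-1$ whose facets (that is, $(d-2)$-dimensional faces) correspond one-to-one to the neighbours $j$ of $i$, in such a way that the facet corresponding to $j$ has outer normal $v_{ij}$ and $(d-2)$-dimensional volume $A_{ij}$. -/

import Mathlib

open scoped MeasureTheory

/-- `M` is a Colin de Verdière matrix for the graph `G`. -/
structure IsColinDeVerdiereMatrix {V : Type*} [Fintype V] (G : SimpleGraph V)
    (M : Matrix V V ℝ) : Prop where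
  symm : M.IsSymm
  neg_of_adj : ∀ i j, G.Adj i j → M i j < 0
  zero_of_not_adj : ∀ i j, i ≠ j → ¬ G.Adj i j → M i j = 0
  /-- There is exactly one negative eigenvalue, and it is simple. -/
  one_neg_eigenvalue : ∃ l : ℝ, l < 0 ∧
    Module.End.HasEigenvalue (Matrix.mulVecLin M) l ∧
    Module.finrank ℝ (Module.End.eigenspace (Matrix.mulVecLin M) l) = 1 ∧
    ∀ l' : ℝ, l' < 0 → Module.End.HasEigenvalue (Matrix.mulVecLin M) l' → l' = l
  /-- The stability condition (strong Arnold property). -/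
  stable : ∀ X : Matrix V V ℝ, X.IsSymm → M * X = 0 →
    (∀ i j, i = j ∨ G.Adj i j → X i j = 0) → X = 0

/-- The nullspace representation given by a basis `u` of `ker M`: the vertex `i` is sent to the
vector `v i = (u₁ i, …, u_d i)` of `ℝ^d`. -/
noncomputable def nullspaceRepresentation {V : Type*} [Fintype V] {M : Matrix V V ℝ} {d : ℕ}
    (u : Module.Basis (Fin d) ℝ (LinearMap.ker (Matrix.mulVecLin M))) (i : V) :
    EuclideanSpace ℝ (Fin d) :=
  WithLp.toLp 2 (fun a => (u a : V → ℝ) i)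

section

variable {E : Type*} [NormedAddCommGroup E] [InnerProductSpace ℝ E]

/-- The projection of `y` on the hyperplane `x^⊥`. -/
noncomputable def projPerp (x y : E) : E := (ℝ ∙ x)ᗮ.starProjection y

/-- The dimension of (the affine hull of) a set. -/
noncomputable def affineDim (S : Set E) : ℕ := Module.finrank ℝ (vectorSpan ℝ S)

/-- A convex polytope: the convex hull of a nonempty finite set of points. -/
def IsConvexPolytope (P : Set E) : Prop :=
  ∃ s : Finset E, s.Nonempty ∧ P = convexHull ℝ (s : Set E)

/-- A facet of `P`: a nonempty (exposed) face of dimension one less than that of `P`. -/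
def IsFacet (P B : Set E) : Prop :=
  B.Nonempty ∧ IsExposed ℝ P B ∧ affineDim B + 1 = affineDim P

/-- The face of `P` with outer normal `w`. -/
def faceWithNormal (P : Set E) (w : E) : Set E :=
  {p ∈ P | ∀ q ∈ P, inner ℝ w q ≤ inner ℝ w p}

end

/-! Project row `i` of `M u_a = 0` to `v_i^⊥`: the diagonal term dies and `∑ M_ij v_ij = 0` remains,
summed over the neighbours of `i`. As `‖v_ij‖ = ‖v_j‖ sin θ_ij`, this says that the unit normals
along `v_ij`, weighted by `A_ij > 0`, add up to zero, so Minkowski's existence theorem applies in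
`v_i^⊥`.

Minkowski's theorem is proved variationally. Let `P(h)` be cut out by `⟪n_i, x⟫ ≤ h_i`, and maximize
`vol P(h) * exp(-∑ a_i h_i)`. Balance of the weighted normals makes this invariant under
translations of `P(h)`, so `h ≥ 0` may be assumed, and there the exponential beats the polynomial
growth of the volume (`exists_forall_measure_mul_exp_le`). The derivative of the volume in `h_i` is
the volume of the `i`-th face (`hasDerivAt_measure_polyhedron`), so at a maximum that face has
volume `a_i V` with `V = vol P(h)`; a dilation removes the factor `V`. Positive face volumes force
the right dimensions, and every facet lies in one of the bounding hyperplanes. -/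

/-! ### Polyhedra with fixed normals: boundedness and continuity of measure -/

section Polyhedron

open Filter Topology MeasureTheory

variable {E : Type*} [NormedAddCommGroup E] [InnerProductSpace ℝ E] {ι : Type*}

/-- The polyhedron with outer normals `n i` and support parameters `h i`. -/
def polyhedron (n : ι → E) (h : ι → ℝ) : Set E := {x | ∀ i, inner ℝ (n i) x ≤ h i}

theorem polyhedron_translate (n : ι → E) (h : ι → ℝ) (x : E) :
    polyhedron n (fun i => h i - inner ℝ (n i) x) = (fun y => y + x) ⁻¹' polyhedron n h := by
  ext y
  simp [polyhedron, inner_add_right, le_sub_iff_add_le]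

theorem isClosed_polyhedron (n : ι → E) (h : ι → ℝ) : IsClosed (polyhedron n h) := by
  simp only [polyhedron, Set.ofPred_forall]
  exact isClosed_iInter fun i => isClosed_le (by fun_prop) continuous_const

theorem convex_polyhedron (n : ι → E) (h : ι → ℝ) : Convex ℝ (polyhedron n h) := by
  intro x hx y hy s t hs ht hst i
  rw [inner_add_right, inner_smul_right, inner_smul_right]
  calc s * inner ℝ (n i) x + t * inner ℝ (n i) y ≤ s * h i + t * h i := by
        gcongr
        · exact hx i
        · exact hy i
    _ = h i := by rw [← add_mul, hst, one_mul]

/-- Since `∑ a_k ⟪n_k, x⟫ = 0`, upper bounds on all the `⟪n_k, x⟫` give lower bounds on each;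
spanning makes `x ↦ (⟪n_k, x⟫)_k` injective, so these control `‖x‖`. That `C` does not depend on `h`
gives the polynomial volume bound. -/
theorem exists_polyhedron_subset_closedBall [Fintype ι] [FiniteDimensional ℝ E] {n : ι → E}
    {a : ι → ℝ} (ha : ∀ i, 0 < a i) (hsum : ∑ i, a i • n i = 0)
    (hspan : Submodule.span ℝ (Set.range n) = ⊤) :
    ∃ C : ℝ, 0 < C ∧ ∀ (h : ι → ℝ) (R : ℝ), 0 ≤ R → (∀ i, h i ≤ R) →
      polyhedron n h ⊆ Metric.closedBall 0 (C * R) := by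
  let L : E →ₗ[ℝ] (ι → ℝ) := LinearMap.pi fun i => (innerₛₗ ℝ (n i))
  have hL : LinearMap.ker L = ⊥ := by
    rw [LinearMap.ker_eq_bot']
    intro x hx
    have h1 : ∀ i, inner ℝ (n i) x = 0 := fun i => congrFun hx i
    have h2 : x ∈ (Submodule.span ℝ (Set.range n))ᗮ := by
      rw [Submodule.mem_orthogonal]
      intro u hu
      induction hu using Submodule.span_induction with
      | mem y hy => obtain ⟨i, rfl⟩ := hy; exact h1 i
      | zero => simp
      | add y z _ _ hy hz => rw [inner_add_left, hy, hz, add_zero]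
      | smul c y _ hy => rw [inner_smul_left, hy, mul_zero]
    simpa [hspan] using h2
  obtain ⟨K, hK, hLK⟩ := L.exists_antilipschitzWith hL
  let D : ℝ := 1 + ∑ i, (∑ k, a k) / a i
  have hA : 0 ≤ ∑ k, a k := Finset.sum_nonneg fun k _ => (ha k).le
  have hDi : ∀ i, (∑ k, a k) / a i ≤ ∑ i, (∑ k, a k) / a i := fun i =>
    Finset.single_le_sum (f := fun i => (∑ k, a k) / a i)
      (fun k _ => div_nonneg hA (ha k).le) (Finset.mem_univ i)
  have hD0 : 0 ≤ ∑ i, (∑ k, a k) / a i :=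
    Finset.sum_nonneg fun k _ => div_nonneg hA (ha k).le
  have hD : 0 < D := by positivity
  refine ⟨K * D, mul_pos hK hD, fun h R hR hh x hx => ?_⟩
  have hle : ∀ i, inner ℝ (n i) x ≤ R := fun i => (hx i).trans (hh i)
  have h0 : ∑ k, a k * inner ℝ (n k) x = 0 := by
    have := congrArg (fun y => inner ℝ y x) hsum
    simpa [sum_inner, inner_smul_left] using this
  have hge : ∀ i, -((∑ k, a k) / a i * R) ≤ inner ℝ (n i) x := by
    intro i
    have h3 : ∑ k, a k * (R - inner ℝ (n k) x) = (∑ k, a k) * R := by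
      simp only [mul_sub, Finset.sum_sub_distrib, h0, sub_zero, Finset.sum_mul]
    have h4 : a i * (R - inner ℝ (n i) x) ≤ (∑ k, a k) * R := by
      rw [← h3]
      exact Finset.single_le_sum (f := fun k => a k * (R - inner ℝ (n k) x))
        (fun k _ => mul_nonneg (ha k).le (sub_nonneg.2 (hle k))) (Finset.mem_univ i)
    have h5 : R - inner ℝ (n i) x ≤ (∑ k, a k) / a i * R := by
      rw [div_mul_eq_mul_div, le_div_iff₀ (ha i)]; linarith
    linarith
  have hnorm : ‖L x‖ ≤ D * R := by
    rw [pi_norm_le_iff_of_nonneg (by positivity)]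
    intro i
    change |inner ℝ (n i) x| ≤ D * R
    have := mul_le_mul_of_nonneg_right (hDi i) hR
    have hDR : D * R = R + (∑ i, (∑ k, a k) / a i) * R := by simp only [D]; ring
    have h6 := mul_nonneg hD0 hR
    rw [abs_le]
    constructor <;> linarith [hle i, hge i]
  have := hLK.le_mul_dist x 0
  rw [map_zero, dist_zero_right, dist_zero_right] at this
  rw [mem_closedBall_zero_iff, mul_assoc]
  exact this.trans (by gcongr)

theorem measurableSet_polyhedron [MeasurableSpace E] [BorelSpace E] (n : ι → E) (h : ι → ℝ) :
    MeasurableSet (polyhedron n h) := (isClosed_polyhedron n h).measurableSet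

/-- Off the limiting hyperplanes membership is eventually constant, so dominated convergence
applies. The measure is left general to cover both Haar measure and the measure of a hyperplane. -/
theorem tendsto_measure_polyhedron [Fintype ι] [MeasurableSpace E] [BorelSpace E] (ν : Measure E)
    {X : Type*} {l : Filter X} [l.IsCountablyGenerated] {n : ι → E} {b : X → ι → ℝ} {b₀ : ι → ℝ}
    (hb : Tendsto b l (𝓝 b₀)) (hnull : ∀ k, ν {y | inner ℝ (n k) y = b₀ k} = 0) {K : Set E}
    (hK : MeasurableSet K) (hνK : ν K ≠ ⊤) (hsub : ∀ᶠ t in l, polyhedron n (b t) ⊆ K) :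
    Tendsto (fun t => ν (polyhedron n (b t))) l (𝓝 (ν (polyhedron n b₀))) := by
  refine tendsto_measure_of_ae_tendsto_indicator l (measurableSet_polyhedron n b₀)
    (fun t => measurableSet_polyhedron n (b t)) hK hνK hsub ?_
  have hae : ∀ᵐ y ∂ν, ∀ k, inner ℝ (n k) y ≠ b₀ k := ae_all_iff.2 fun k => by
    rw [ae_iff]; simpa using hnull k
  rw [tendsto_pi_nhds] at hb
  filter_upwards [hae] with y hy
  by_cases hmem : y ∈ polyhedron n b₀
  · have : ∀ᶠ t in l, ∀ k, inner ℝ (n k) y < b t k := eventually_all.2 fun k =>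
      (hb k).eventually (lt_mem_nhds (lt_of_le_of_ne (hmem k) (hy k)))
    filter_upwards [this] with t ht
    exact ⟨fun _ => hmem, fun _ k => (ht k).le⟩
  · have hmem' := hmem
    simp only [polyhedron, Set.mem_ofPred_eq, not_forall, not_le] at hmem'
    obtain ⟨k, hk⟩ := hmem'
    filter_upwards [(hb k).eventually (gt_mem_nhds hk)] with t ht
    exact ⟨fun h => absurd (h k) (not_le.2 ht), fun h => absurd h hmem⟩

theorem measure_inner_eq_zero [FiniteDimensional ℝ E] [MeasurableSpace E] [BorelSpace E]
    (ν : Measure E) [ν.IsAddHaarMeasure] {w : E} (hw : w ≠ 0) (c : ℝ) :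
    ν {y | inner ℝ w y = c} = 0 := by
  let s : AffineSubspace ℝ E := AffineSubspace.mk' ((c / ‖w‖ ^ 2) • w) (ℝ ∙ w)ᗮ
  have hw2 : ‖w‖ ^ 2 ≠ 0 := by positivity
  have hmem : ∀ y, y ∈ s ↔ inner ℝ w y = c := by
    intro y
    rw [AffineSubspace.mem_mk', Submodule.mem_orthogonal_singleton_iff_inner_right, vsub_eq_sub,
      inner_sub_right, inner_smul_right, real_inner_self_eq_norm_sq, div_mul_cancel₀ _ hw2,
      sub_eq_zero]
  have hs : s ≠ ⊤ := by
    intro h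
    have h1 := (hmem 0).1 (h ▸ AffineSubspace.mem_top ℝ E 0)
    have h2 := (hmem w).1 (h ▸ AffineSubspace.mem_top ℝ E w)
    rw [inner_zero_right] at h1
    rw [real_inner_self_eq_norm_sq, ← h1] at h2
    exact hw2 h2
  have := Measure.addHaar_affineSubspace ν s hs
  convert this using 2
  ext y
  exact (hmem y).symm

end Polyhedron

/-! ### Existence of a maximizer -/

section Maximizer

open Filter Topology MeasureTheory

variable {E : Type*} [NormedAddCommGroup E] [InnerProductSpace ℝ E] [FiniteDimensional ℝ E]
  [MeasurableSpace E] [BorelSpace E] {ι : Type*} [Fintype ι]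

theorem continuous_measureReal_polyhedron (ν : Measure E) [ν.IsAddHaarMeasure] {n : ι → E}
    (hn : ∀ i, n i ≠ 0) {a : ι → ℝ} (ha : ∀ i, 0 < a i) (hsum : ∑ i, a i • n i = 0)
    (hspan : Submodule.span ℝ (Set.range n) = ⊤) :
    Continuous fun h => ν.real (polyhedron n h) := by
  obtain ⟨C, hC, hsub⟩ := exists_polyhedron_subset_closedBall ha hsum hspan
  rw [continuous_iff_continuousAt]
  intro h₀
  have hfin : ∀ r : ℝ, ν (Metric.closedBall (0 : E) r) ≠ ⊤ := fun r =>
    measure_closedBall_lt_top.ne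
  have hb : ν (polyhedron n h₀) ≠ ⊤ :=
    ((measure_mono (hsub h₀ ‖h₀‖ (norm_nonneg _)
      fun i => (le_abs_self _).trans (norm_le_pi_norm h₀ i))).trans_lt (hfin _).lt_top).ne
  refine (ENNReal.tendsto_toReal hb).comp ?_
  refine tendsto_measure_polyhedron ν tendsto_id (fun k => measure_inner_eq_zero ν (hn k) _)
    Metric.isClosed_closedBall.measurableSet (hfin (C * (‖h₀‖ + 1))) ?_
  have h1 : ∀ᶠ h in 𝓝 h₀, ‖h‖ < ‖h₀‖ + 1 :=
    continuous_norm.continuousAt.eventually (gt_mem_nhds (lt_add_one _))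
  filter_upwards [h1] with h hh
  exact hsub h _ (by positivity) fun i =>
    ((le_abs_self _).trans (norm_le_pi_norm h i)).trans hh.le

/-- The function `h ↦ vol (P h) * exp (-⟪a, h⟫)` attains its maximum. -/
theorem exists_forall_measure_mul_exp_le (ν : Measure E) [ν.IsAddHaarMeasure] {n : ι → E}
    (hn : ∀ i, ‖n i‖ = 1) {a : ι → ℝ} (ha : ∀ i, 0 < a i) (hsum : ∑ i, a i • n i = 0)
    (hspan : Submodule.span ℝ (Set.range n) = ⊤) :
    ∃ h : ι → ℝ, 0 < ν.real (polyhedron n h) ∧ ∀ h' : ι → ℝ,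
      ν.real (polyhedron n h') * Real.exp (-∑ i, a i * h' i) ≤
        ν.real (polyhedron n h) * Real.exp (-∑ i, a i * h i) := by
  obtain ⟨C, hC, hsub⟩ := exists_polyhedron_subset_closedBall ha hsum hspan
  have hn0 : ∀ i, n i ≠ 0 := fun i h => by simpa [h] using hn i
  have hfin : ∀ r : ℝ, ν (Metric.closedBall (0 : E) r) ≠ ⊤ := fun r =>
    measure_closedBall_lt_top.ne
  have hbdd : ∀ h, polyhedron n h ⊆ Metric.closedBall 0 (C * ‖h‖) := fun h =>
    hsub h ‖h‖ (norm_nonneg _) fun i => (le_abs_self _).trans (norm_le_pi_norm h i)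
  let g : (ι → ℝ) → ℝ := fun h => ν.real (polyhedron n h) * Real.exp (-∑ i, a i * h i)
  have hg : Continuous g := (continuous_measureReal_polyhedron ν hn0 ha hsum hspan).mul
    (Real.continuous_exp.comp (by fun_prop))
  have hone : 0 < ν.real (polyhedron n fun _ => 1) := by
    refine ENNReal.toReal_pos (ne_of_gt ?_)
      ((measure_mono (hbdd _)).trans_lt (hfin _).lt_top).ne
    refine (Metric.measure_ball_pos ν (0 : E) one_pos).trans_le (measure_mono fun x hx i => ?_)
    refine (real_inner_le_norm _ _).trans ?_
    rw [hn i, one_mul]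
    exact (mem_ball_zero_iff.1 hx).le
  have hgone : 0 < g fun _ => 1 := mul_pos hone (Real.exp_pos _)
  obtain ⟨c, hc, hca⟩ : ∃ c : ℝ, 0 < c ∧ ∀ i, c ≤ a i := by
    rcases isEmpty_or_nonempty ι with hι | hι
    · exact ⟨1, one_pos, fun i => hι.elim i⟩
    · obtain ⟨i, hi⟩ := Finite.exists_min a
      exact ⟨a i, ha i, hi⟩
  let B := ν.real (Metric.ball (0 : E) 1)
  have hdecay : Tendsto (fun t : ℝ => (C * t) ^ Module.finrank ℝ E * B * Real.exp (-(c * t)))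
      atTop (𝓝 0) := by
    have h1 := (Real.tendsto_pow_mul_exp_neg_atTop_nhds_zero (Module.finrank ℝ E)).comp
      (tendsto_id.const_mul_atTop hc)
    have h2 := h1.const_mul ((C / c) ^ Module.finrank ℝ E * B)
    rw [mul_zero] at h2
    refine h2.congr fun t => ?_
    simp only [Function.comp_apply, id_eq]
    have : C * t = C / c * (c * t) := by field_simp
    rw [this, mul_pow]
    ring
  have hle : ∀ h : ι → ℝ, (∀ i, 0 ≤ h i) →
      g h ≤ (C * ‖h‖) ^ Module.finrank ℝ E * B * Real.exp (-(c * ‖h‖)) := by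
    intro h hh
    have h1 : ν.real (polyhedron n h) ≤ (C * ‖h‖) ^ Module.finrank ℝ E * B := by
      have h2 := ENNReal.toReal_mono (hfin (C * ‖h‖)) (measure_mono (μ := ν) (hbdd h))
      rwa [Measure.addHaar_closedBall ν 0 (by positivity), ENNReal.toReal_mul,
        ENNReal.toReal_ofReal (by positivity)] at h2
    have h3 : c * ‖h‖ ≤ ∑ i, a i * h i := by
      rw [← le_div_iff₀' hc, pi_norm_le_iff_of_nonneg
        (div_nonneg (Finset.sum_nonneg fun i _ => mul_nonneg (ha i).le (hh i)) hc.le)]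
      intro i
      rw [Real.norm_of_nonneg (hh i), le_div_iff₀' hc]
      exact (mul_le_mul_of_nonneg_right (hca i) (hh i)).trans
        (Finset.single_le_sum (f := fun i => a i * h i)
          (fun i _ => mul_nonneg (ha i).le (hh i)) (Finset.mem_univ i))
    exact mul_le_mul h1 (Real.exp_le_exp.2 (neg_le_neg h3)) (Real.exp_pos _).le (by positivity)
  obtain ⟨h, _, hmax⟩ := hg.continuousOn.exists_isMaxOn' (s := {h | ∀ i, 0 ≤ h i})
    (by
      simp only [Set.ofPred_forall]
      exact isClosed_iInter fun i => isClosed_le continuous_const (continuous_apply i))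
    (x₀ := fun _ => 1) (fun _ => zero_le_one) (by
      rw [eventually_inf_principal]
      filter_upwards [(hdecay.comp (tendsto_norm_cocompact_atTop (E := ι → ℝ))).eventually
        (gt_mem_nhds hgone)] with h hh hmem
      exact (hle h hmem).trans hh.le)
  have hmax1 : g (fun _ => 1) ≤ g h := hmax (fun _ => zero_le_one)
  refine ⟨h, pos_of_mul_pos_left (hgone.trans_le hmax1) (Real.exp_pos _).le, fun h' => ?_⟩
  -- Translating a point `x` of `P(h')` to the origin makes all parameters nonnegative and changes
  -- neither the volume nor `∑ a_i h'_i`.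
  rcases (polyhedron n h').eq_empty_or_nonempty with hemp | ⟨x, hx⟩
  · rw [hemp, measureReal_empty, zero_mul]
    exact hgone.le.trans hmax1
  · have h1 : g (fun i => h' i - inner ℝ (n i) x) ≤ g h :=
      hmax fun i => sub_nonneg.2 (hx i)
    have h2 : ∑ i, a i * inner ℝ (n i) x = 0 := by
      have := congrArg (fun y => inner ℝ y x) hsum
      simpa [sum_inner, inner_smul_left] using this
    have h3 : g (fun i => h' i - inner ℝ (n i) x) = g h' := by
      simp only [g, polyhedron_translate, mul_sub, Finset.sum_sub_distrib, h2, sub_zero]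
      rw [measureReal_def, measureReal_def, measure_preimage_add_right]
    rw [h3] at h1
    exact h1

end Maximizer

/-! ### Slicing by hyperplanes and the derivative of the volume -/

section Slices

open Filter Topology MeasureTheory Measure

variable {E : Type*} [NormedAddCommGroup E] [InnerProductSpace ℝ E] [FiniteDimensional ℝ E]

omit [FiniteDimensional ℝ E] in
theorem finrank_orthogonal_span_singleton_eq {m : ℕ} (hm : Module.finrank ℝ E = m + 1) {w : E}
    (hw : w ≠ 0) : Module.finrank ℝ (ℝ ∙ w)ᗮ = m := by
  have : Fact (Module.finrank ℝ E = m + 1) := ⟨hm⟩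
  exact Submodule.finrank_orthogonal_span_singleton hw

variable [MeasurableSpace E] [BorelSpace E]

/-- The Lebesgue measure of the hyperplane `w^⊥`, as a measure on the whole space. -/
noncomputable def hyperplaneMeasure (w : E) : Measure E :=
  (μHE[Module.finrank ℝ (ℝ ∙ w)ᗮ] : Measure (ℝ ∙ w)ᗮ).map Subtype.val

instance (w : E) : SFinite (hyperplaneMeasure w) := by
  unfold hyperplaneMeasure; infer_instance

omit [FiniteDimensional ℝ E] in
theorem hyperplaneMeasure_apply (w : E) {A : Set E} (hA : MeasurableSet A) :
    hyperplaneMeasure w A =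
      (μHE[Module.finrank ℝ (ℝ ∙ w)ᗮ] : Measure (ℝ ∙ w)ᗮ) (Subtype.val ⁻¹' A) :=
  map_apply measurable_subtype_coe hA

omit [FiniteDimensional ℝ E] in
theorem hyperplaneMeasure_apply' (w : E) {A : Set E} (hA : MeasurableSet A) :
    hyperplaneMeasure w A = μHE[Module.finrank ℝ (ℝ ∙ w)ᗮ] (A ∩ ((ℝ ∙ w)ᗮ : Submodule ℝ E)) := by
  rw [hyperplaneMeasure_apply w hA, isometry_subtype_coe.euclideanHausdorffMeasure_preimage,
    Subtype.range_coe]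

theorem hyperplaneMeasure_lt_top (w : E) {A : Set E} (hA : MeasurableSet A)
    (hb : Bornology.IsBounded A) : hyperplaneMeasure w A < ⊤ := by
  rw [hyperplaneMeasure_apply w hA]
  have : Bornology.IsBounded (Subtype.val ⁻¹' A : Set (ℝ ∙ w)ᗮ) :=
    isometry_subtype_coe.antilipschitz.isBounded_preimage hb
  exact this.measure_lt_top

theorem hyperplaneMeasure_inner_eq_zero {w x : E} {c : ℝ}
    (hc : x ∈ (ℝ ∙ w : Submodule ℝ E) → c ≠ 0) :
    hyperplaneMeasure w {y | inner ℝ x y = c} = 0 := by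
  have hmeas : MeasurableSet {y | inner ℝ x y = c} :=
    (isClosed_eq (by fun_prop) continuous_const).measurableSet
  rw [hyperplaneMeasure_apply w hmeas]
  by_cases hx : x ∈ (ℝ ∙ w : Submodule ℝ E)
  · have : (Subtype.val ⁻¹' {y | inner ℝ x y = c} : Set (ℝ ∙ w)ᗮ) = ∅ := by
      rw [Set.eq_empty_iff_forall_notMem]
      intro y hy
      have h1 : inner ℝ x (y : E) = 0 := (Submodule.mem_orthogonal _ _).1 y.2 x hx
      exact hc hx (h1 ▸ hy : (0 : ℝ) = c).symm
    rw [this, measure_empty]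
  · have hp : (ℝ ∙ w)ᗮ.orthogonalProjectionOnto x ≠ 0 := by
      rw [Ne, Submodule.orthogonalProjectionOnto_eq_zero_iff, Submodule.orthogonal_orthogonal]
      exact hx
    convert measure_inner_eq_zero (E := (ℝ ∙ w)ᗮ) μHE[Module.finrank ℝ (ℝ ∙ w)ᗮ] hp c using 2
    ext y
    simp only [Set.mem_preimage, Set.mem_ofPred_eq]
    rw [← Submodule.inner_orthogonalProjectionOnto_eq_of_mem_right]

variable {ι : Type*}

omit [FiniteDimensional ℝ E] in
-- Translating the slice by `-s • w` into `w^⊥` leaves a fixed measure, with `s` entering only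
-- through the parameters.
theorem measure_polyhedron_inter_hyperplane {m : ℕ} (hm : Module.finrank ℝ E = m + 1) {w : E}
    (hw : ‖w‖ = 1) (n : ι → E) (h : ι → ℝ) (s : ℝ) :
    μHE[m] (polyhedron n h ∩ {y | inner ℝ w y = s}) =
      hyperplaneMeasure w (polyhedron n fun k => h k - inner ℝ (n k) (s • w)) := by
  have hw0 : w ≠ 0 := fun h => by simp [h] at hw
  rw [hyperplaneMeasure_apply' w (measurableSet_polyhedron _ _),
    finrank_orthogonal_span_singleton_eq hm hw0, polyhedron_translate,
    ← measure_preimage_add_right μHE[m] (s • w)]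
  congr 1
  ext y
  simp only [Set.mem_preimage, Set.mem_inter_iff, Set.mem_ofPred_eq, SetLike.mem_coe,
    Submodule.mem_orthogonal_singleton_iff_inner_right, inner_add_right, inner_smul_right,
    real_inner_self_eq_norm_sq, hw]
  norm_num

theorem measure_eq_lintegral_hyperplane {m : ℕ} (hm : Module.finrank ℝ E = m + 1) {w : E}
    (hw : ‖w‖ = 1) {t : Set E} (ht : MeasurableSet t) :
    μHE[m + 1] t = ∫⁻ s : ℝ, μHE[m] (t ∩ {y | inner ℝ w y = s}) := by
  have hw0 : w ≠ 0 := fun h => by simp [h] at hw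
  have := EuclideanGeometry.euclideanHausdorffMeasure_eq_lintegral (0 : E) hw0 ht
  rw [hm, Nat.add_sub_cancel] at this
  rw [this, ← ofReal_norm, hw, ENNReal.ofReal_one, one_mul]
  congr 1
  ext s
  congr 2
  ext y
  rw [SetLike.mem_coe, AffineSubspace.mem_mk', Submodule.mem_orthogonal_singleton_iff_inner_right]
  simp only [vsub_eq_sub, vadd_eq_add, add_zero, inner_sub_right, inner_smul_right,
    real_inner_self_eq_norm_sq, hw, Set.mem_ofPred_eq]
  norm_num [sub_eq_zero]

theorem measurable_measure_polyhedron_inter_hyperplane [Fintype ι] {m : ℕ}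
    (hm : Module.finrank ℝ E = m + 1) {w : E} (hw : ‖w‖ = 1) (n : ι → E) (h : ι → ℝ) :
    Measurable fun s : ℝ => μHE[m] (polyhedron n h ∩ {y | inner ℝ w y = s}) := by
  simp only [measure_polyhedron_inter_hyperplane hm hw]
  refine measurable_measure_prodMk_left (ν := hyperplaneMeasure w)
    (s := {q : ℝ × E | ∀ k, inner ℝ (n k) q.2 ≤ h k - inner ℝ (n k) (q.1 • w)}) ?_
  simp only [Set.ofPred_forall]
  exact (isClosed_iInter fun k => isClosed_le (by fun_prop) (by fun_prop)).measurableSet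

/-- Slices at levels `s ≤ c` do not see whether the `i`-th bound is `c` or `r`. The integrand is
thus independent of `c`, ready for the fundamental theorem of calculus. -/
theorem measure_polyhedron_update [DecidableEq ι] {m : ℕ}
    (hm : Module.finrank ℝ E = m + 1) {n : ι → E} {i : ι} (hi : ‖n i‖ = 1) (h : ι → ℝ) {c r : ℝ}
    (hc : c ≤ r) :
    μHE[m + 1] (polyhedron n (Function.update h i c)) = ∫⁻ s in Set.Iic c,
      μHE[m] (polyhedron n (Function.update h i r) ∩ {y | inner ℝ (n i) y = s}) := by
  rw [measure_eq_lintegral_hyperplane hm hi (measurableSet_polyhedron _ _),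
    ← lintegral_indicator measurableSet_Iic]
  congr 1
  ext s
  by_cases hs : s ≤ c
  · rw [Set.indicator_of_mem (Set.mem_Iic.2 hs)]
    congr 1
    ext y
    simp only [Set.mem_inter_iff, Set.mem_ofPred_eq, polyhedron, and_congr_left_iff]
    rintro rfl
    refine forall_congr' fun k => ?_
    rcases eq_or_ne k i with rfl | hk
    · simp [hs, hs.trans hc]
    · simp [hk]
  · rw [Set.indicator_of_notMem (by simpa using hs)]
    convert measure_empty (μ := (μHE[m] : Measure E)) using 2
    rw [Set.eq_empty_iff_forall_notMem]
    rintro y ⟨hy, rfl⟩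
    have := hy i
    rw [Function.update_self] at this
    exact hs this

theorem hasDerivAt_measure_polyhedron [Fintype ι] [DecidableEq ι] {m : ℕ}
    (hm : Module.finrank ℝ E = m + 1) {n : ι → E} (hn : ∀ i, ‖n i‖ = 1)
    (hray : ∀ i j, i ≠ j → ¬ SameRay ℝ (n i) (n j)) {a : ι → ℝ}
    (ha : ∀ i, 0 < a i) (hsum : ∑ i, a i • n i = 0)
    (hspan : Submodule.span ℝ (Set.range n) = ⊤) (h : ι → ℝ)
    (hpos : 0 < (μHE[m + 1] : Measure E).real (polyhedron n h)) (i : ι) :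
    HasDerivAt (fun c => (μHE[m + 1] : Measure E).real (polyhedron n (Function.update h i c)))
      ((μHE[m] : Measure E).real (polyhedron n h ∩ {y | inner ℝ (n i) y = h i})) (h i) := by
  obtain ⟨C, hC, hsub⟩ := exists_polyhedron_subset_closedBall ha hsum hspan
  have hbdd : ∀ g : ι → ℝ, Bornology.IsBounded (polyhedron n g) := fun g =>
    Metric.isBounded_closedBall.subset (hsub g ‖g‖ (norm_nonneg _)
      fun i => (le_abs_self _).trans (norm_le_pi_norm g i))
  -- Relaxing the `i`-th bound by `1` keeps the slice function from jumping to zero just above `h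
  -- i`.
  set h₁ : ι → ℝ := Function.update h i (h i + 1) with hh₁
  let T : ℝ → ENNReal := fun s => μHE[m] (polyhedron n h₁ ∩ {y | inner ℝ (n i) y = s})
  have hT : Measurable T := measurable_measure_polyhedron_inter_hyperplane hm (hn i) n h₁
  have hTeq : ∀ s, T s = hyperplaneMeasure (n i)
      (polyhedron n fun k => h₁ k - inner ℝ (n k) (s • n i)) := fun s =>
    measure_polyhedron_inter_hyperplane hm (hn i) n h₁ s
  have hTfin : ∀ s, T s < ⊤ := fun s => by
    rw [hTeq]
    exact hyperplaneMeasure_lt_top _ (measurableSet_polyhedron _ _) (hbdd _)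
  have hV : ∀ c, c ≤ h i + 1 →
      μHE[m + 1] (polyhedron n (Function.update h i c)) = ∫⁻ s in Set.Iic c, T s := fun c hc =>
    measure_polyhedron_update hm (hn i) h hc
  have hfinV : ∀ g, μHE[m + 1] (polyhedron n g) < ⊤ := fun g => by
    rw [← hm]; exact (hbdd g).measure_lt_top
  have hint : ∀ c, c ≤ h i + 1 → IntegrableOn (fun s => (T s).toReal) (Set.Iic c) := fun c hc =>
    integrable_toReal_of_lintegral_ne_top hT.aemeasurable (by rw [← hV c hc]; exact (hfinV _).ne)
  have hVr : ∀ c, c ≤ h i + 1 →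
      (μHE[m + 1] : Measure E).real (polyhedron n (Function.update h i c)) =
        ∫ s in Set.Iic c, (T s).toReal := fun c hc => by
    rw [integral_toReal hT.aemeasurable (ae_of_all _ hTfin), ← hV c hc]
    rfl
  have hcont : ContinuousAt (fun s => (T s).toReal) (h i) := by
    refine (ENNReal.tendsto_toReal (hTfin _).ne).comp ?_
    rw [hTeq (h i), show T = _ from funext hTeq]
    have hb : Continuous fun (s : ℝ) (k : ι) => h₁ k - inner ℝ (n k) (s • n i) := by fun_prop
    refine tendsto_measure_polyhedron (hyperplaneMeasure (n i)) hb.continuousAt ?_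
      Metric.isClosed_closedBall.measurableSet
      (hyperplaneMeasure_lt_top (n i) (A := Metric.closedBall 0
        (C * (‖fun k => h₁ k - inner ℝ (n k) (h i • n i)‖ + 1)))
        Metric.isClosed_closedBall.measurableSet Metric.isBounded_closedBall).ne ?_
    · intro k
      refine hyperplaneMeasure_inner_eq_zero fun hk => ?_
      obtain ⟨t, ht⟩ := Submodule.mem_span_singleton.1 hk
      have ht1 : |t| = 1 := by
        have := hn k
        rwa [← ht, norm_smul, hn i, mul_one, Real.norm_eq_abs] at this
      rcases eq_or_ne k i with rfl | hki
      · simp [hh₁, inner_smul_right, hn]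
      · have ht' : t = -1 := by
          rcases eq_or_eq_neg_of_abs_eq ht1 with h1 | h1
          · refine absurd ?_ (hray k i hki)
            rw [← ht, h1, one_smul]
          · exact h1
        subst ht'
        rw [neg_one_smul] at ht
        rw [hh₁, Function.update_of_ne hki, ← ht, inner_smul_right, inner_neg_left,
          real_inner_self_eq_norm_sq, hn i]
        -- An opposite normal with `h k = -h i` would squeeze the polyhedron into a hyperplane,
        -- against its positive volume.
        intro h0
        have hk0 : h k = -h i := by linarith
        have hflat : polyhedron n h ⊆ {y | inner ℝ (n i) y = h i} := by
          intro y hy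
          have h1 := hy i
          have h2 := hy k
          rw [← ht, inner_neg_left, hk0] at h2
          exact le_antisymm h1 (by linarith)
        have hni : n i ≠ 0 := fun h => by simpa [h] using hn i
        have := measure_mono_null hflat
          (measure_inner_eq_zero μHE[Module.finrank ℝ E] hni (h i))
        rw [hm] at this
        rw [measureReal_def, this] at hpos
        simp at hpos
    · have h1 := (hb.norm.continuousAt (x := h i)).eventually (gt_mem_nhds (lt_add_one _))
      filter_upwards [h1] with s hs
      exact hsub _ _ (by positivity) fun k =>
        ((le_abs_self _).trans
          (norm_le_pi_norm (fun k => h₁ k - inner ℝ (n k) (s • n i)) k)).trans hs.le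
  have hTi : T (h i) = μHE[m] (polyhedron n h ∩ {y | inner ℝ (n i) y = h i}) := by
    simp only [T]
    congr 1
    ext y
    simp only [Set.mem_inter_iff, Set.mem_ofPred_eq, polyhedron, and_congr_left_iff]
    intro hy
    refine forall_congr' fun k => ?_
    rcases eq_or_ne k i with rfl | hk
    · simp [hh₁, hy]
    · simp [hh₁, hk]
  have hderiv : HasDerivAt (fun c => ∫ s in (h i)..c, (T s).toReal) (T (h i)).toReal (h i) :=
    intervalIntegral.integral_hasDerivAt_right (by simp)
      hT.ennreal_toReal.stronglyMeasurable.stronglyMeasurableAtFilter hcont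
  rw [hTi, ← measureReal_def] at hderiv
  refine (hderiv.const_add (∫ s in Set.Iic (h i), (T s).toReal)).congr_of_eventuallyEq ?_
  filter_upwards [gt_mem_nhds (lt_add_one (h i))] with c hc
  rw [hVr c hc.le, ← intervalIntegral.integral_Iic_sub_Iic (hint _ (by linarith)) (hint c hc.le)]
  ring

end Slices

/-! ### The critical point equation and rescaling -/

section Optimum

open Filter Topology MeasureTheory Measure
open scoped Pointwise

variable {E : Type*} [NormedAddCommGroup E] [InnerProductSpace ℝ E] {ι : Type*}

theorem polyhedron_smul (n : ι → E) (h : ι → ℝ) {r : ℝ} (hr : 0 < r) :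
    polyhedron n (r • h) = r • polyhedron n h := by
  ext y
  rw [Set.mem_smul_set_iff_inv_smul_mem₀ hr.ne']
  refine forall_congr' fun k => ?_
  rw [inner_smul_right, Pi.smul_apply, smul_eq_mul, inv_mul_le_iff₀ hr]

theorem polyhedron_smul_inter_hyperplane (n : ι → E) (h : ι → ℝ) {r : ℝ} (hr : 0 < r) (i : ι) :
    polyhedron n (r • h) ∩ {y | inner ℝ (n i) y = (r • h) i} =
      r • (polyhedron n h ∩ {y | inner ℝ (n i) y = h i}) := by
  rw [Set.smul_set_inter₀ hr.ne', polyhedron_smul n h hr]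
  congr 1
  ext y
  rw [Set.mem_smul_set_iff_inv_smul_mem₀ hr.ne', Set.mem_ofPred_eq, Set.mem_ofPred_eq,
    inner_smul_right, Pi.smul_apply, smul_eq_mul, inv_mul_eq_iff_eq_mul₀ hr.ne']

variable [FiniteDimensional ℝ E] [MeasurableSpace E] [BorelSpace E] [Fintype ι]

/-- Minkowski's existence theorem, in terms of support parameters. -/
theorem exists_polyhedron_measure_eq {m : ℕ} (hm : Module.finrank ℝ E = m + 1) (hm0 : m ≠ 0)
    {n : ι → E} (hn : ∀ i, ‖n i‖ = 1) (hray : ∀ i j, i ≠ j → ¬ SameRay ℝ (n i) (n j)) {a : ι → ℝ}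
    (ha : ∀ i, 0 < a i) (hsum : ∑ i, a i • n i = 0)
    (hspan : Submodule.span ℝ (Set.range n) = ⊤) :
    ∃ h : ι → ℝ, 0 < μHE[m + 1] (polyhedron n h) ∧ ∀ i,
      μHE[m] (polyhedron n h ∩ {y | inner ℝ (n i) y = h i}) = ENNReal.ofReal (a i) := by
  classical
  have : (μHE[m + 1] : Measure E).IsAddHaarMeasure := by rw [← hm]; infer_instance
  obtain ⟨h, hpos, hmax⟩ := exists_forall_measure_mul_exp_le μHE[m + 1] hn ha hsum hspan
  set V := (μHE[m + 1] : Measure E).real (polyhedron n h) with hV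
  have hface : ∀ i, (μHE[m] : Measure E).real (polyhedron n h ∩ {y | inner ℝ (n i) y = h i}) =
      a i * V := by
    intro i
    have hd := hasDerivAt_measure_polyhedron hm hn hray ha hsum hspan h hpos i
    have he : HasDerivAt (fun c => Real.exp (-(∑ k, a k * h k + a i * (c - h i))))
        (Real.exp (-(∑ k, a k * h k + a i * (h i - h i))) * -(a i * 1)) (h i) :=
      (((((hasDerivAt_id (h i)).sub_const (h i)).const_mul (a i)).const_add _).neg).exp
    have hsumu : ∀ c, ∑ k, a k * Function.update h i c k = ∑ k, a k * h k + a i * (c - h i) := by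
      intro c
      rw [← sub_eq_iff_eq_add', ← Finset.sum_sub_distrib, Finset.sum_eq_single i]
      · simp [mul_sub]
      · intro k _ hk
        simp [hk]
      · simp
    have hloc : IsLocalMax (fun c =>
        (μHE[m + 1] : Measure E).real (polyhedron n (Function.update h i c)) *
          Real.exp (-(∑ k, a k * h k + a i * (c - h i)))) (h i) := by
      refine Eventually.of_forall fun c => ?_
      have := hmax (Function.update h i c)
      rw [hsumu] at this
      simpa using this
    have := hloc.hasDerivAt_eq_zero (hd.mul he)
    simp only [Function.update_eq_self, sub_self, mul_zero, add_zero, mul_one, ← hV] at this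
    have hexp := Real.exp_pos (-∑ k, a k * h k)
    have h2 : ((μHE[m] : Measure E).real (polyhedron n h ∩ {y | inner ℝ (n i) y = h i}) - a i * V) *
        Real.exp (-∑ k, a k * h k) = 0 := by linarith
    exact sub_eq_zero.1 ((mul_eq_zero.1 h2).resolve_right hexp.ne')
  -- Dilation by `r` multiplies face volumes by `r ^ m`, and they are `a i * V`, so `r ^ m = V⁻¹` is
  -- needed; this uses `m ≠ 0`.
  let r : ℝ := V⁻¹ ^ ((m : ℝ)⁻¹)
  have hr : 0 < r := Real.rpow_pos_of_pos (inv_pos.2 hpos) _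
  have hrm : r ^ m = V⁻¹ := Real.rpow_inv_natCast_pow (inv_pos.2 hpos).le hm0
  refine ⟨r • h, ?_, fun i => ?_⟩
  · rw [polyhedron_smul n h hr, euclideanHausdorffMeasure_smul₀ _ hr.ne', ENNReal.smul_def,
      smul_eq_mul]
    refine ENNReal.mul_pos ?_ ?_
    · simpa using hr.ne'
    · intro h0
      rw [hV, measureReal_def, h0] at hpos
      simp at hpos
  · have hne : μHE[m] (polyhedron n h ∩ {y | inner ℝ (n i) y = h i}) ≠ ⊤ := by
      intro htop
      have := hface i
      rw [measureReal_def, htop, ENNReal.toReal_top] at this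
      exact (mul_pos (ha i) hpos).ne this
    rw [polyhedron_smul_inter_hyperplane n h hr, euclideanHausdorffMeasure_smul₀ _ hr.ne',
      ← ENNReal.ofReal_toReal hne, ← measureReal_def, hface, ENNReal.smul_def, smul_eq_mul,
      ← ENNReal.ofReal_coe_nnreal, ← ENNReal.ofReal_mul (NNReal.coe_nonneg _)]
    congr 1
    rw [NNReal.coe_pow, coe_nnnorm, Real.norm_of_nonneg hr.le, hrm]
    field_simp

end Optimum

/-! ### Faces of polyhedra and their dimensions -/

section Faces

open Filter Topology MeasureTheory Measure

variable {E : Type*} [NormedAddCommGroup E] [InnerProductSpace ℝ E] {ι : Type*}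

theorem eventually_add_smul_mem_polyhedron [Finite ι] {n : ι → E} {h : ι → ℝ} {x v : E}
    (hx : x ∈ polyhedron n h) (hv : ∀ i, inner ℝ (n i) x = h i → inner ℝ (n i) v = 0) :
    ∀ᶠ t : ℝ in 𝓝 0, x + t • v ∈ polyhedron n h := by
  refine eventually_all.2 fun i => ?_
  rcases (hx i).lt_or_eq with hlt | heq
  · have hc : Continuous fun t : ℝ => inner ℝ (n i) (x + t • v) := by fun_prop
    have h0 : inner ℝ (n i) (x + (0 : ℝ) • v) < h i := by simpa using hlt
    filter_upwards [(hc.continuousAt (x := 0)).eventually (gt_mem_nhds h0)] with t ht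
    exact ht.le
  · refine Eventually.of_forall fun t => ?_
    rw [inner_add_right, inner_smul_right, hv i heq, mul_zero, add_zero, heq]

/-- An extreme point is determined by its set of tight constraints: if `x` and `y` share it, `x` can
move both ways along `x - y`. -/
theorem finite_extremePoints_polyhedron [Finite ι] (n : ι → E) (h : ι → ℝ) :
    ((polyhedron n h).extremePoints ℝ).Finite := by
  refine Set.Finite.of_injOn (f := fun x => {i | inner ℝ (n i) x = h i}) (t := Set.univ)
    (fun _ _ => Set.mem_univ _) ?_ Set.finite_univ
  intro x hx y hy hxy
  by_contra hne
  have htight : ∀ i, inner ℝ (n i) x = h i → inner ℝ (n i) (x - y) = 0 := by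
    intro i hi
    have : inner ℝ (n i) y = h i := (Set.ext_iff.1 hxy i).1 hi
    rw [inner_sub_right, hi, this, sub_self]
  have hpos := eventually_add_smul_mem_polyhedron hx.1 htight
  have hneg : ∀ᶠ t : ℝ in 𝓝 0, x + (-t) • (x - y) ∈ polyhedron n h :=
    (continuous_neg.tendsto' (0 : ℝ) 0 neg_zero).eventually hpos
  obtain ⟨t, ⟨h1, h2⟩, ht⟩ := (((hpos.and hneg).filter_mono nhdsWithin_le_nhds).and
    (self_mem_nhdsWithin (a := (0 : ℝ)) (s := Set.Ioi 0))).exists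
  have hseg : x ∈ openSegment ℝ (x + t • (x - y)) (x + (-t) • (x - y)) := by
    refine ⟨1 / 2, 1 / 2, by norm_num, by norm_num, by norm_num, ?_⟩
    module
  have := hx.2 h1 h2 hseg
  rw [add_eq_left, smul_eq_zero, sub_eq_zero] at this
  exact this.elim (fun h => (ne_of_gt ht) h) hne

theorem isConvexPolytope_polyhedron [Finite ι] [FiniteDimensional ℝ E] {n : ι → E} {h : ι → ℝ}
    (hb : Bornology.IsBounded (polyhedron n h)) (hne : (polyhedron n h).Nonempty) :
    IsConvexPolytope (polyhedron n h) := by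
  have hfin := finite_extremePoints_polyhedron n h
  have hcomp : IsCompact (polyhedron n h) :=
    Metric.isCompact_of_isClosed_isBounded (isClosed_polyhedron n h) hb
  refine ⟨hfin.toFinset, ?_, ?_⟩
  · rw [Set.Finite.toFinset_nonempty]
    exact hcomp.extremePoints_nonempty hne
  · rw [Set.Finite.coe_toFinset, ← (hfin.isCompact_convexHull ℝ).isClosed.closure_eq,
      closure_convexHull_extremePoints hcomp (convex_polyhedron n h)]

theorem faceWithNormal_smul (P : Set E) (w : E) {c : ℝ} (hc : 0 < c) :
    faceWithNormal P (c • w) = faceWithNormal P w := by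
  simp only [faceWithNormal, real_inner_smul_left, mul_le_mul_iff_right₀ hc]

theorem faceWithNormal_polyhedron {n : ι → E} {h : ι → ℝ} {i : ι}
    (hne : (polyhedron n h ∩ {y | inner ℝ (n i) y = h i}).Nonempty) :
    faceWithNormal (polyhedron n h) (n i) = polyhedron n h ∩ {y | inner ℝ (n i) y = h i} := by
  obtain ⟨p, hp, hpi⟩ := hne
  ext x
  refine and_congr_right fun hx => ⟨fun hmax => ?_, fun hxi q hq => ?_⟩
  · exact le_antisymm (hx i) (hpi.symm.le.trans (hmax p hp))
  · exact (hq i).trans_eq (Eq.symm hxi)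

theorem vectorSpan_le_orthogonal {S : Set E} {w : E} {c : ℝ} (hS : ∀ x ∈ S, inner ℝ w x = c) :
    vectorSpan ℝ S ≤ (ℝ ∙ w)ᗮ := by
  rw [vectorSpan_def, Submodule.span_le]
  rintro _ ⟨x, hx, y, hy, rfl⟩
  change x - y ∈ (ℝ ∙ w)ᗮ
  rw [Submodule.mem_orthogonal_singleton_iff_inner_right, inner_sub_right, hS x hx, hS y hy,
    sub_self]

theorem affineDim_le_of_inner_eq [FiniteDimensional ℝ E] {m : ℕ}
    (hm : Module.finrank ℝ E = m + 1) {S : Set E} {w : E} (hw : w ≠ 0) {c : ℝ}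
    (hS : ∀ x ∈ S, inner ℝ w x = c) : affineDim S ≤ m :=
  (Submodule.finrank_mono (vectorSpan_le_orthogonal hS)).trans_eq
    (finrank_orthogonal_span_singleton_eq hm hw)

/-- A bounded set has finite measure in the dimension of its affine hull, hence measure zero in any
higher one. This turns positive volume into a lower bound on dimension. -/
theorem measure_eq_zero_of_affineDim_lt [MeasurableSpace E] [BorelSpace E] [FiniteDimensional ℝ E]
    {S : Set E} (hS : Bornology.IsBounded S) {k : ℕ} (hk : affineDim S < k) : μHE[k] S = 0 := by
  rcases S.eq_empty_or_nonempty with rfl | ⟨p, hp⟩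
  · exact measure_empty
  let f : vectorSpan ℝ S → E := fun y => (y : E) + p
  have hf : Isometry f := (isometry_add_right p).comp isometry_subtype_coe
  have himg : f '' (f ⁻¹' S) = S := by
    refine Set.image_preimage_eq_of_subset fun x hx => ?_
    exact ⟨⟨x - p, vsub_mem_vectorSpan ℝ hx hp⟩, sub_add_cancel x p⟩
  rw [← himg, hf.euclideanHausdorffMeasure_image]
  have hbd : Bornology.IsBounded (f ⁻¹' S) := hf.antilipschitz.isBounded_preimage hS
  refine (euclideanHausdorffMeasure_zero_or_top hk (f ⁻¹' S)).resolve_right ?_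
  change μHE[Module.finrank ℝ (vectorSpan ℝ S)] (f ⁻¹' S) ≠ ⊤
  exact hbd.measure_lt_top.ne

/-- Otherwise each constraint is slack somewhere on the face. The average of such points lies on the
face and is slack for all constraints, so it can move along `w`, against maximality. -/
theorem exists_faceWithNormal_subset [Fintype ι] {n : ι → E} {h : ι → ℝ} {w : E} (hw : w ≠ 0)
    (hne : (faceWithNormal (polyhedron n h) w).Nonempty) :
    ∃ i, ∀ x ∈ faceWithNormal (polyhedron n h) w, inner ℝ (n i) x = h i := by
  by_contra! hcon
  choose b hb hbne using hcon
  have hlt : ∀ i, inner ℝ (n i) (b i) < h i := fun i => lt_of_le_of_ne ((hb i).1 i) (hbne i)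
  have hconv : Convex ℝ (faceWithNormal (polyhedron n h) w) := by
    intro x hx y hy s t hs ht hst
    refine ⟨convex_polyhedron n h hx.1 hy.1 hs ht hst, fun q hq => ?_⟩
    rw [inner_add_right, inner_smul_right, inner_smul_right]
    calc inner ℝ w q = s * inner ℝ w q + t * inner ℝ w q := by rw [← add_mul, hst, one_mul]
      _ ≤ _ := by
        gcongr
        · exact hx.2 q hq
        · exact hy.2 q hq
  obtain ⟨p, hp, hplt⟩ : ∃ p ∈ faceWithNormal (polyhedron n h) w, ∀ i, inner ℝ (n i) p < h i := by
    rcases isEmpty_or_nonempty ι with hι | hι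
    · exact ⟨_, hne.some_mem, fun i => hι.elim i⟩
    have hN : (0 : ℝ) < Fintype.card ι := by exact_mod_cast Fintype.card_pos
    have hone : ∑ _i : ι, (Fintype.card ι : ℝ)⁻¹ = 1 := by
      rw [Finset.sum_const, Finset.card_univ, nsmul_eq_mul, mul_inv_cancel₀ hN.ne']
    refine ⟨∑ i, (Fintype.card ι : ℝ)⁻¹ • b i,
      hconv.sum_mem (fun _ _ => (inv_pos.2 hN).le) hone fun i _ => hb i, fun k => ?_⟩
    rw [inner_sum]
    calc ∑ i, inner ℝ (n k) ((Fintype.card ι : ℝ)⁻¹ • b i)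
        < ∑ _i : ι, (Fintype.card ι : ℝ)⁻¹ * h k := by
          refine Finset.sum_lt_sum (fun i _ => ?_) ⟨k, Finset.mem_univ k, ?_⟩
          · rw [inner_smul_right]
            exact mul_le_mul_of_nonneg_left ((hb i).1 k) (inv_pos.2 hN).le
          · rw [inner_smul_right]
            exact mul_lt_mul_of_pos_left (hlt k) (inv_pos.2 hN)
      _ = h k := by rw [← Finset.sum_mul, hone, one_mul]
  have hev := eventually_add_smul_mem_polyhedron (v := w) hp.1
    fun i hi => absurd hi (hplt i).ne
  obtain ⟨t, h1, ht⟩ := ((hev.filter_mono nhdsWithin_le_nhds).and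
    (self_mem_nhdsWithin (a := (0 : ℝ)) (s := Set.Ioi 0))).exists
  have := hp.2 _ h1
  rw [inner_add_right, inner_smul_right, real_inner_self_eq_norm_sq] at this
  have h2 : 0 < t * ‖w‖ ^ 2 := mul_pos ht (by positivity)
  linarith

/-- By dimension the face has direction space `u^⊥`, so `w = t • u`. If `t < 0`, then `P` lies in a
hyperplane; if `t = 0`, the face is all of `P`; both contradict the dimensions. -/
theorem exists_pos_smul_of_faceWithNormal [FiniteDimensional ℝ E] {m : ℕ}
    (hm : Module.finrank ℝ E = m + 1) {P : Set E} (hP : affineDim P = m + 1) {u w : E} {c : ℝ}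
    (hu : u ≠ 0) (hPu : ∀ x ∈ P, inner ℝ u x ≤ c) (hne : (faceWithNormal P w).Nonempty)
    (hdim : affineDim (faceWithNormal P w) = m)
    (hface : ∀ x ∈ faceWithNormal P w, inner ℝ u x = c) : ∃ t : ℝ, 0 < t ∧ w = t • u := by
  obtain ⟨p, hp⟩ := hne
  have h1 : vectorSpan ℝ (faceWithNormal P w) = (ℝ ∙ u)ᗮ :=
    Submodule.eq_of_le_of_finrank_eq (vectorSpan_le_orthogonal hface)
      (hdim.trans (finrank_orthogonal_span_singleton_eq hm hu).symm)
  have h2 : vectorSpan ℝ (faceWithNormal P w) ≤ (ℝ ∙ w)ᗮ :=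
    vectorSpan_le_orthogonal (c := inner ℝ w p) fun x hx =>
      le_antisymm (hp.2 x hx.1) (hx.2 p hp.1)
  rw [h1] at h2
  have h3 := Submodule.orthogonal_le h2
  rw [Submodule.orthogonal_orthogonal, Submodule.orthogonal_orthogonal] at h3
  obtain ⟨t, rfl⟩ := Submodule.mem_span_singleton.1 (h3 (Submodule.mem_span_singleton_self w))
  refine ⟨t, ?_, rfl⟩
  by_contra! ht
  rcases ht.lt_or_eq with ht | rfl
  · have hflat : ∀ x ∈ P, inner ℝ u x = c := by
      intro x hx
      refine le_antisymm (hPu x hx) ?_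
      have := hp.2 x hx
      rw [real_inner_smul_left, real_inner_smul_left, hface p hp] at this
      exact (mul_le_mul_left_of_neg ht).1 this
    have := affineDim_le_of_inner_eq hm hu hflat
    omega
  · have : faceWithNormal P ((0 : ℝ) • u) = P := by simp [faceWithNormal]
    rw [this] at hdim
    omega

/-- Minkowski's existence theorem: a finite family of pairwise non-parallel vectors spanning the
space is the family of outer facet normals of a convex polytope with prescribed facet volumes,
provided the weighted normals add up to zero. -/
theorem exists_polytope_of_normals [MeasurableSpace E] [BorelSpace E] [FiniteDimensional ℝ E]
    [Fintype ι] {m : ℕ} (hm : Module.finrank ℝ E = m + 1) (hm0 : m ≠ 0)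
    {w : ι → E} (hw : ∀ i, w i ≠ 0) (hray : ∀ i j, i ≠ j → ¬ SameRay ℝ (w i) (w j)) {a : ι → ℝ}
    (ha : ∀ i, 0 < a i) (hsum : ∑ i, (a i / ‖w i‖) • w i = 0)
    (hspan : Submodule.span ℝ (Set.range w) = ⊤) :
    ∃ P : Set E, IsConvexPolytope P ∧ affineDim P = m + 1 ∧
      (∀ i, (faceWithNormal P (w i)).Nonempty) ∧ (∀ i, affineDim (faceWithNormal P (w i)) = m) ∧
      (∀ i, μHE[m] (faceWithNormal P (w i)) = ENNReal.ofReal (a i)) ∧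
      Function.Injective (fun i => faceWithNormal P (w i)) ∧
      ∀ x, (faceWithNormal P x).Nonempty → affineDim (faceWithNormal P x) = m →
        ∃ i, faceWithNormal P x = faceWithNormal P (w i) := by
  have hw' : ∀ i, 0 < ‖w i‖ := fun i => norm_pos_iff.2 (hw i)
  let n : ι → E := fun i => ‖w i‖⁻¹ • w i
  have hn : ∀ i, ‖n i‖ = 1 := fun i => norm_smul_inv_norm (𝕜 := ℝ) (hw i)
  have hn0 : ∀ i, n i ≠ 0 := fun i => smul_ne_zero (inv_pos.2 (hw' i)).ne' (hw i)
  have hwn : ∀ i, w i = ‖w i‖ • n i := fun i => by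
    simp only [n, smul_smul, mul_inv_cancel₀ (hw' i).ne', one_smul]
  have hray' : ∀ i j, i ≠ j → ¬ SameRay ℝ (n i) (n j) := fun i j hij hs => by
    refine hray i j hij ?_
    rw [hwn i, hwn j]
    exact (hs.nonneg_smul_left (hw' i).le).nonneg_smul_right (hw' j).le
  have hsum' : ∑ i, a i • n i = 0 := by
    rw [← hsum]
    simp only [n, smul_smul, div_eq_mul_inv]
  have hspan' : Submodule.span ℝ (Set.range n) = ⊤ := by
    rw [eq_top_iff, ← hspan, Submodule.span_le]
    rintro _ ⟨i, rfl⟩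
    rw [hwn i]
    exact Submodule.smul_mem _ _ (Submodule.subset_span ⟨i, rfl⟩)
  obtain ⟨h, hpos, hface⟩ := exists_polyhedron_measure_eq hm hm0 hn hray' ha hsum' hspan'
  obtain ⟨C, -, hC⟩ := exists_polyhedron_subset_closedBall ha hsum' hspan'
  have hbdd : Bornology.IsBounded (polyhedron n h) :=
    Metric.isBounded_closedBall.subset (hC h ‖h‖ (norm_nonneg _)
      fun i => (le_abs_self _).trans (norm_le_pi_norm h i))
  have hdimP : affineDim (polyhedron n h) = m + 1 := by
    refine le_antisymm ((Submodule.finrank_le _).trans_eq hm) ?_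
    by_contra! hlt
    exact hpos.ne' (measure_eq_zero_of_affineDim_lt hbdd hlt)
  have hFpos : ∀ i, 0 < μHE[m] (polyhedron n h ∩ {y | inner ℝ (n i) y = h i}) := fun i => by
    rw [hface i, ENNReal.ofReal_pos]; exact ha i
  have hFn : ∀ i, faceWithNormal (polyhedron n h) (n i) =
      polyhedron n h ∩ {y | inner ℝ (n i) y = h i} := fun i =>
    faceWithNormal_polyhedron (nonempty_of_measure_ne_zero (hFpos i).ne')
  have hF : ∀ i, faceWithNormal (polyhedron n h) (w i) =
      polyhedron n h ∩ {y | inner ℝ (n i) y = h i} := fun i => by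
    rw [hwn i, faceWithNormal_smul _ _ (hw' i), hFn]
  have hFne : ∀ i, (faceWithNormal (polyhedron n h) (w i)).Nonempty := fun i => by
    rw [hF]; exact nonempty_of_measure_ne_zero (hFpos i).ne'
  have hFdim : ∀ i, affineDim (faceWithNormal (polyhedron n h) (w i)) = m := fun i => by
    rw [hF]
    refine le_antisymm (affineDim_le_of_inner_eq hm (hn0 i) fun x hx => hx.2) ?_
    by_contra! hlt
    exact (hFpos i).ne' (measure_eq_zero_of_affineDim_lt (hbdd.subset Set.inter_subset_left) hlt)
  have hflat : ∀ {x i}, (faceWithNormal (polyhedron n h) x).Nonempty →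
      affineDim (faceWithNormal (polyhedron n h) x) = m →
      (∀ y ∈ faceWithNormal (polyhedron n h) x, inner ℝ (n i) y = h i) →
      ∃ t : ℝ, 0 < t ∧ x = t • n i := fun {x i} h1 h2 h3 =>
    exists_pos_smul_of_faceWithNormal hm hdimP (hn0 i) (fun y hy => hy i) h1 h2 h3
  refine ⟨polyhedron n h, isConvexPolytope_polyhedron hbdd
    (nonempty_of_measure_ne_zero hpos.ne'), hdimP, hFne, hFdim, fun i => by rw [hF, hface],
    fun i j hij => ?_, fun x hx hxdim => ?_⟩
  · by_contra hne
    have hij' : faceWithNormal (polyhedron n h) (w i) = faceWithNormal (polyhedron n h) (w j) := hij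
    obtain ⟨t, ht, hti⟩ := hflat (x := w i) (i := j) (hFne i) (hFdim i) (by
      rw [hij', hF]; exact fun y hy => hy.2)
    refine hray i j hne ?_
    rw [hti, hwn j]
    exact ((SameRay.refl (n j)).nonneg_smul_left ht.le).nonneg_smul_right (hw' j).le
  · have hx0 : x ≠ 0 := by
      rintro rfl
      have : faceWithNormal (polyhedron n h) (0 : E) = polyhedron n h := by simp [faceWithNormal]
      rw [this] at hxdim
      omega
    obtain ⟨i, hi⟩ := exists_faceWithNormal_subset hx0 hx
    obtain ⟨t, ht, rfl⟩ := hflat hx hxdim hi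
    exact ⟨i, by rw [faceWithNormal_smul _ _ ht, hFn, hF]⟩

end Faces

/-! ### Transfer from a subspace to the ambient space -/

section Subspace

open MeasureTheory

variable {E : Type*} [NormedAddCommGroup E] [InnerProductSpace ℝ E] {W : Submodule ℝ E}

theorem affineDim_image_val (S : Set W) : affineDim (Subtype.val '' S : Set E) = affineDim S := by
  have := AffineMap.map_vectorSpan W.subtype.toAffineMap (s := S)
  unfold affineDim
  have himg : (Subtype.val '' S : Set E) = W.subtype.toAffineMap '' S := rfl
  rw [himg, ← this]
  exact Submodule.finrank_map_subtype_eq W _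

theorem IsConvexPolytope.image_val {P : Set W} (hP : IsConvexPolytope P) :
    IsConvexPolytope (Subtype.val '' P : Set E) := by
  classical
  obtain ⟨s, hs, rfl⟩ := hP
  refine ⟨s.image Subtype.val, hs.image _, ?_⟩
  rw [Finset.coe_image]
  exact W.subtype.image_convexHull (s : Set W)

theorem faceWithNormal_image_val (P : Set W) (w : W) :
    faceWithNormal (Subtype.val '' P : Set E) (w : E) = Subtype.val '' faceWithNormal P w := by
  ext x
  constructor
  · rintro ⟨⟨y, hy, rfl⟩, hmax⟩
    exact ⟨y, ⟨hy, fun q hq => hmax q ⟨q, hq, rfl⟩⟩, rfl⟩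
  · rintro ⟨y, ⟨hy, hmax⟩, rfl⟩
    refine ⟨⟨y, hy, rfl⟩, ?_⟩
    rintro _ ⟨q, hq, rfl⟩
    exact hmax q hq

theorem isExposed_faceWithNormal (P : Set E) (w : E) : IsExposed ℝ P (faceWithNormal P w) :=
  fun _ => ⟨innerSL ℝ w, rfl⟩

/-- Restricted to `W`, the exposing functional is the inner product with a vector of `W`, by Riesz
representation. -/
theorem IsFacet.exists_eq_image_val [FiniteDimensional ℝ W] {P : Set W} {B : Set E}
    (hB : IsFacet (Subtype.val '' P) B) : ∃ w : W, B = Subtype.val '' faceWithNormal P w := by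
  obtain ⟨l, hl⟩ := hB.2.1 hB.1
  let w : W := (InnerProductSpace.toDual ℝ W).symm (l.comp W.subtypeL)
  have hw : ∀ x : W, inner ℝ w x = l x := fun x => by
    simp [w]
  refine ⟨w, ?_⟩
  rw [hl]
  ext x
  constructor
  · rintro ⟨⟨y, hy, rfl⟩, hmax⟩
    refine ⟨y, ⟨hy, fun q hq => ?_⟩, rfl⟩
    rw [hw, hw]
    exact hmax q ⟨q, hq, rfl⟩
  · rintro ⟨y, ⟨hy, hmax⟩, rfl⟩
    refine ⟨⟨y, hy, rfl⟩, ?_⟩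
    rintro _ ⟨q, hq, rfl⟩
    have := hmax q hq
    rwa [hw, hw] at this

theorem norm_projPerp (x y : E) :
    ‖projPerp x y‖ = ‖y‖ * Real.sin (InnerProductGeometry.angle x y) := by
  -- For `x = 0` the angle is `π / 2` by convention and the projection is the identity.
  rcases eq_or_ne x 0 with rfl | hx
  · rw [projPerp, Submodule.starProjection_orthogonal_val]
    simp
  have hx' : 0 < ‖x‖ := norm_pos_iff.2 hx
  have h1 : projPerp x y = y - (inner ℝ x y / ‖x‖ ^ 2) • x := by
    rw [projPerp, Submodule.starProjection_orthogonal_val, Submodule.starProjection_singleton]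
    simp
  have h2 : inner ℝ x y = ‖x‖ * ‖y‖ * Real.cos (InnerProductGeometry.angle x y) := by
    rw [mul_comm, InnerProductGeometry.cos_angle_mul_norm_mul_norm]
  refine (sq_eq_sq₀ (norm_nonneg _) (mul_nonneg (norm_nonneg _)
    (InnerProductGeometry.sin_angle_nonneg x y))).1 ?_
  rw [h1, norm_sub_sq_real, inner_smul_right, norm_smul, real_inner_comm x y, h2, mul_pow, mul_pow,
    Real.norm_eq_abs, sq_abs, Real.sin_sq]
  field_simp
  ring

end Subspace

/-! ### The nullspace representation and the polytopes `F_i` -/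

theorem sum_smul_nullspaceRepresentation {V : Type*} [Fintype V] {M : Matrix V V ℝ} {d : ℕ}
    (u : Module.Basis (Fin d) ℝ (LinearMap.ker (Matrix.mulVecLin M))) (i : V) :
    ∑ j, M i j • nullspaceRepresentation u j = 0 := by
  ext a
  have h : M.mulVec (u a : V → ℝ) i = 0 := congrFun (u a).2 i
  simpa [nullspaceRepresentation, Matrix.mulVec, dotProduct] using h

theorem mainTheorem6 {V : Type*} [Fintype V] (G : SimpleGraph V) (M : Matrix V V ℝ)
    (hM : IsColinDeVerdiereMatrix G M) (d : ℕ) (hd : 3 ≤ d)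
    (u : Module.Basis (Fin d) ℝ (LinearMap.ker (Matrix.mulVecLin M)))
    (v : V → EuclideanSpace ℝ (Fin d)) (hv : v = nullspaceRepresentation u)
    (hv_ne_zero : ∀ i, v i ≠ 0)
    (hv_ne : ∀ i j, i ≠ j → v i ≠ v j)
    (hproj_ne_zero : ∀ i j, G.Adj i j → projPerp (v i) (v j) ≠ 0)
    (hproj_ray : ∀ i j k, G.Adj i j → G.Adj i k → j ≠ k →
      ¬ SameRay ℝ (projPerp (v i) (v j)) (projPerp (v i) (v k)))
    (hproj_span : ∀ i, Submodule.span ℝ ((fun j => projPerp (v i) (v j)) '' {j | G.Adj i j}) =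
      (ℝ ∙ v i)ᗮ) :
    ∀ i, ∃ F : Set (EuclideanSpace ℝ (Fin d)),
      F ⊆ ((ℝ ∙ v i)ᗮ : Submodule ℝ (EuclideanSpace ℝ (Fin d))) ∧
      IsConvexPolytope F ∧ affineDim F = d - 1 ∧
      Set.BijOn (fun j => faceWithNormal F (projPerp (v i) (v j))) {j | G.Adj i j}
        {B | IsFacet F B} ∧
      ∀ j, G.Adj i j →
        μHE[d - 2] (faceWithNormal F (projPerp (v i) (v j))) =
          ENNReal.ofReal
            (-M i j * ‖v i‖ * ‖v j‖ * Real.sin (InnerProductGeometry.angle (v i) (v j))) := by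
  classical
  intro i
  -- Now `v_i^⊥` has dimension `m + 1` and facets have dimension `m`; `3 ≤ d` gives the `m ≠ 0`
  -- needed for rescaling.
  obtain ⟨m, rfl⟩ : ∃ m, d = m + 2 := ⟨d - 2, by omega⟩
  let W : Submodule ℝ (EuclideanSpace ℝ (Fin (m + 2))) := (ℝ ∙ v i)ᗮ
  have hW : Module.finrank ℝ W = m + 1 :=
    finrank_orthogonal_span_singleton_eq (by simp) (hv_ne_zero i)
  let w : {j // G.Adj i j} → W := fun j => W.orthogonalProjectionOnto (v j)
  have hwv : ∀ j, (w j : EuclideanSpace ℝ (Fin (m + 2))) = projPerp (v i) (v j) := fun _ => rfl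
  have hwnorm : ∀ j, ‖w j‖ = ‖projPerp (v i) (v j)‖ := fun j => by rw [← hwv]; rfl
  have hw : ∀ j, w j ≠ 0 := fun j h => hproj_ne_zero i j j.2 (by rw [← hwv, h]; rfl)
  have hray : ∀ j k, j ≠ k → ¬ SameRay ℝ (w j) (w k) := fun j k hjk hs =>
    hproj_ray i j k j.2 k.2 (fun h => hjk (Subtype.ext h)) (hs.map W.subtype)
  -- This is `A_ij`, by `norm_projPerp`.
  let a : {j // G.Adj i j} → ℝ := fun j => -M i j * ‖v i‖ * ‖w j‖
  have ha : ∀ j, 0 < a j := fun j =>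
    mul_pos (mul_pos (neg_pos.2 (hM.neg_of_adj i j j.2)) (norm_pos_iff.2 (hv_ne_zero i)))
      (norm_pos_iff.2 (hw j))
  have hsum : ∑ j, (a j / ‖w j‖) • w j = 0 := by
    have h1 : ∑ j, M i j • W.orthogonalProjectionOnto (v j) = 0 := by
      have := congrArg W.orthogonalProjectionOnto (sum_smul_nullspaceRepresentation u i)
      rw [← hv] at this
      simpa using this
    have h2 : ∑ j : {j // G.Adj i j}, M i j • w j = 0 := by
      let g : V → W := fun j => M i j • W.orthogonalProjectionOnto (v j)
      have h3 : ∑ j with G.Adj i j, g j = ∑ j, g j := by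
        refine Finset.sum_subset (Finset.subset_univ _) fun j _ hj => ?_
        rw [Finset.mem_filter_univ] at hj
        -- Outside the neighbours, either `j = i` and the projection kills `v i`, or `M i j = 0`.
        rcases eq_or_ne i j with rfl | hij
        · have : W.orthogonalProjectionOnto (v i) = 0 := by
            rw [Submodule.orthogonalProjectionOnto_eq_zero_iff, Submodule.orthogonal_orthogonal]
            exact Submodule.mem_span_singleton_self _
          simp only [g, this, smul_zero]
        · simp only [g, hM.zero_of_not_adj i j hij hj, zero_smul]
      rw [Finset.sum_subtype _ (fun j => Finset.mem_filter_univ j) g] at h3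
      exact h3.trans h1
    calc ∑ j, (a j / ‖w j‖) • w j = ∑ j : {j // G.Adj i j}, (-‖v i‖) • (M i j • w j) := by
          refine Finset.sum_congr rfl fun j _ => ?_
          rw [smul_smul]
          congr 1
          have := (norm_pos_iff.2 (hw j)).ne'
          simp only [a]
          field_simp
      _ = 0 := by rw [← Finset.smul_sum, h2, smul_zero]
  have hspan : Submodule.span ℝ (Set.range w) = ⊤ := by
    apply Submodule.map_injective_of_injective W.injective_subtype
    rw [Submodule.map_span, Submodule.map_subtype_top, ← Set.range_comp]
    refine Eq.trans ?_ (hproj_span i)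
    congr 1
    ext x
    simp [hwv]
  obtain ⟨P, hP, hPdim, hne, hdim, hvol, hinj, hsurj⟩ :=
    exists_polytope_of_normals hW (by omega) hw hray ha hsum hspan
  have hface : ∀ j (hj : G.Adj i j), faceWithNormal (Subtype.val '' P) (projPerp (v i) (v j)) =
      Subtype.val '' faceWithNormal P (w ⟨j, hj⟩) := fun j hj =>
    faceWithNormal_image_val P (w ⟨j, hj⟩)
  refine ⟨Subtype.val '' P, ?_, hP.image_val, ?_, ⟨?_, ?_, ?_⟩, ?_⟩
  · rintro _ ⟨x, -, rfl⟩
    exact x.2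
  · rw [affineDim_image_val, hPdim]
    rfl
  · intro j hj
    refine ⟨?_, isExposed_faceWithNormal _ _, ?_⟩
    · simp only [hface j hj]
      exact (hne _).image _
    · simp only [hface j hj, affineDim_image_val, hdim, hPdim]
  · intro j hj k hk hjk
    simp only [hface j hj, hface k hk] at hjk
    exact congrArg Subtype.val (hinj (Subtype.val_injective.image_injective hjk))
  · intro B hB
    obtain ⟨x, rfl⟩ := hB.exists_eq_image_val
    have hx := hB.2.2
    rw [affineDim_image_val, affineDim_image_val, hPdim, add_left_inj] at hx
    obtain ⟨j, hj⟩ := hsurj x hB.1.of_image hx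
    exact ⟨j, j.2, by rw [hj]; exact hface j j.2⟩
  · intro j hj
    rw [hface j hj, isometry_subtype_coe.euclideanHausdorffMeasure_image]
    refine (hvol ⟨j, hj⟩).trans ?_
    simp only [a, hwnorm, norm_projPerp, mul_assoc]
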